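/- Let $A$ be a finite-dimensional real vector space with an abstract state space $(A,\Omega_A,u_A)$: $\Omega_A\subset A$ is convex and compact, $A_+:=\mathbb R_{\ge 0}\cdot\Omega_A$ is a closed generating cone (non-empty, closed under sums and under multiplication by nonnegative reals, with $A_+\cap(-A_+)=\{0\}$ and $\operatorname{span}A_+=A$), and $u_A:A\to\mathbb R$ is linear with $u_A(w)>0$ for all $0\ne w\in A_+$ and, for $w\in A_+$, $u_A(w)=1\Leftrightarrow w\in\Omega_A$. Elements of $\Omega_A$ are called states, and the extreme points of $\Omega_A$ pure states. An effect is a linear map $e:A\to\mathbb R$ with $0\le e\le u_A$ on $A_+$. Let $\mathcal E_A$ be a non-empty set of effects (the allowed effects) such that $e\in\mathcal E_A$ implies $u_A-e\in\mathcal E_A$, and $e,f\in\mathcal E_A$ with $e+f\le u_A$ on $A_+$ implies $e+f\in\mathcal E_A$. Let $\mathcal G_A$ be a group (the reversible transformations) of invertible linear maps $T:A\to A$ with $T(A_+)\subset A_+$ and $u_A\circ T\le u_A$ on $A_+$, such that $e\circ T\in\mathcal E_A$ for all $e\in\mathcal E_A$, $T\in\mathcal G_A$. States $w_1,\dots,w_n$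 are perfectly distinguishable if there are $e_1,\dots,e_n\in\mathcal E_A$ with $\sum_j e_j\le u_A$ on $A_+$ and $e_j(w_k)=\delta_{jk}$ for all $j,k$. A classical decomposition of a state $w$ is a representation $w=\sum_{j=1}^n p_jw_j$ with $p_j\ge 0$, $\sum_j p_j=1$ and $w_1,\dots,w_n$ perfectly distinguishable pure states. Assume: 1. (Classical decomposability) Every state has a classical decomposition. 2. (Strong symmetry) For every $n\in\mathbb N$, whenever $w_1,\dots,w_n$ and $v_1,\dots,v_n$ are perfectly distinguishable pure states, there is $T\in\mathcal G_A$ with $T(w_j)=v_j$ for all $j$. Then for any two classical decompositions $w=\sum_{j=1}^m p_jw_j=\sum_{k=1}^n q_kw_k'$ of a state $w$, the coefficients agree up to permutation and zeros: there is a bijection $\sigma:\{j: p_j\ne 0\}\to\{k: q_k\ne 0\}$ with $q_{\sigma(j)}=p_j$ for all $j$; and $-\sum_j p_j\ln p_j=-\sum_k q_k\ln q_k$ (with $0\ln 0:=0$). Hence the entropy $S(w):=-\sum_j p_j\ln p_j$ is well-defined: for every state $w$ there is exactly one real number $S(w)$ that equals $-\sum_j p_j\ln p_j$ for every classical decomposition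 $w=\sum_j p_jw_j$. -/

import Mathlib

/-! Generalized probabilistic theories: abstract state spaces, allowed effects, reversible
transformations, perfectly distinguishable states and classical decompositions.
The finite-dimensional real space `A` is taken with a norm only to speak of its (unique)
vector space topology. -/

namespace GPT

section

variable {A : Type*} [NormedAddCommGroup A] [NormedSpace ℝ A]

/-- A (pointed, convex) cone: `K + K ⊆ K`, `p K ⊆ K` for `p ≥ 0`, and `K ∩ (-K) = {0}`. -/
structure IsCone (K : Set A) : Prop where
  nonempty : K.Nonempty
  add_mem : ∀ x ∈ K, ∀ y ∈ K, x + y ∈ K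
  smul_mem : ∀ p : ℝ, 0 ≤ p → ∀ x ∈ K, p • x ∈ K
  pointed : ∀ x ∈ K, -x ∈ K → x = 0

/-- The set `ℝ_{≥ 0} · Ω` of all nonnegative multiples of elements of `Ω`. -/
def nonnegMultiples (Ω : Set A) : Set A :=
  {x | ∃ t : ℝ, 0 ≤ t ∧ ∃ w ∈ Ω, x = t • w}

/-- An abstract state space `(A, Ω, u)` on a finite-dimensional real vector space `A`. -/
structure AbstractStateSpace (A : Type*) [NormedAddCommGroup A] [NormedSpace ℝ A]
    [FiniteDimensional ℝ A] where
  /-- the set `Ω` of normalized states -/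
  states : Set A
  /-- the order unit `u`, which gives the normalization -/
  unit : Module.Dual ℝ A
  convex_states : Convex ℝ states
  isCompact_states : IsCompact states
  isCone : IsCone (nonnegMultiples states)
  isClosed_cone : IsClosed (nonnegMultiples states)
  generating : Submodule.span ℝ (nonnegMultiples states) = ⊤
  unit_pos : ∀ w ∈ nonnegMultiples states, w ≠ 0 → 0 < unit w
  unit_eq_one_iff : ∀ w ∈ nonnegMultiples states, unit w = 1 ↔ w ∈ states

variable [FiniteDimensional ℝ A]

namespace AbstractStateSpace

/-- The cone `A₊` of unnormalized states. -/
def cone (S : AbstractStateSpace A) : Set A := nonnegMultiples S.states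

/-- Effects: linear functionals `e` with `0 ≤ e ≤ u` on `A₊`. -/
def IsEffect (S : AbstractStateSpace A) (e : Module.Dual ℝ A) : Prop :=
  ∀ w ∈ S.cone, 0 ≤ e w ∧ e w ≤ S.unit w

/-- Transformations: positive linear maps that do not increase the normalization. -/
def IsTransformation (S : AbstractStateSpace A) (T : A →ₗ[ℝ] A) : Prop :=
  (∀ w ∈ S.cone, T w ∈ S.cone) ∧ ∀ w ∈ S.cone, S.unit (T w) ≤ S.unit w

/-- Pure states: the extreme points of the set of states. -/
def pureStates (S : AbstractStateSpace A) : Set A := S.states.extremePoints ℝ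

end AbstractStateSpace

/-- A dynamical state space: an abstract state space with a set of physically allowed effects
and the group of (physically allowed) reversible transformations.
The allowed effects need not be all effects. With an allowed effect its counter-event is allowed,
as is the sum of two allowed effects that stays below `u`, and as is an allowed effect measured
after a reversible transformation.
Since the reversible transformations form a group of transformations, so are their inverses. -/
structure DynamicalStateSpace (A : Type*) [NormedAddCommGroup A] [NormedSpace ℝ A]
    [FiniteDimensional ℝ A] extends AbstractStateSpace A where
  /-- the set of allowed effects -/
  allowedEffects : Set (Module.Dual ℝ A)
  /-- the group of reversible transformations -/
  reversible : Subgroup (A ≃ₗ[ℝ] A)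
  allowedEffects_nonempty : allowedEffects.Nonempty
  isEffect_of_allowed : ∀ e ∈ allowedEffects, toAbstractStateSpace.IsEffect e
  compl_allowed : ∀ e ∈ allowedEffects, unit - e ∈ allowedEffects
  add_allowed : ∀ e ∈ allowedEffects, ∀ f ∈ allowedEffects,
    (∀ w ∈ toAbstractStateSpace.cone, (e + f) w ≤ unit w) → e + f ∈ allowedEffects
  isTransformation_of_reversible : ∀ T ∈ reversible,
    toAbstractStateSpace.IsTransformation (T : A →ₗ[ℝ] A)
  comp_allowed : ∀ e ∈ allowedEffects, ∀ T ∈ reversible,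
    e ∘ₗ (T : A →ₗ[ℝ] A) ∈ allowedEffects

namespace DynamicalStateSpace

/-- States `w₁, …, wₙ` are perfectly distinguishable if there are allowed effects `e₁, …, eₙ`
with `∑ eⱼ ≤ u` and `eⱼ(wₖ) = δⱼₖ`. -/
def PerfectlyDistinguishable (S : DynamicalStateSpace A) {n : ℕ} (w : Fin n → A) : Prop :=
  (∀ j, w j ∈ S.states) ∧
  ∃ e : Fin n → Module.Dual ℝ A,
    (∀ j, e j ∈ S.allowedEffects) ∧
    (∀ x ∈ S.cone, ∑ j, e j x ≤ S.unit x) ∧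
    ∀ j k, e j (w k) = if j = k then 1 else 0

/-- A frame: perfectly distinguishable pure states. -/
def IsFrame (S : DynamicalStateSpace A) {n : ℕ} (w : Fin n → A) : Prop :=
  (∀ j, w j ∈ S.pureStates) ∧ S.PerfectlyDistinguishable w

/-- `x = ∑ pⱼ wⱼ` is a classical decomposition: `p` is a probability distribution and the `wⱼ`
are perfectly distinguishable pure states. -/
structure IsClassicalDecomposition (S : DynamicalStateSpace A) (x : A) {n : ℕ}
    (p : Fin n → ℝ) (w : Fin n → A) : Prop where
  nonneg : ∀ j, 0 ≤ p j
  sum_eq_one : ∑ j, p j = 1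
  isFrame : S.IsFrame w
  eq_sum : x = ∑ j, p j • w j

/-- Classical decomposability: every state has a classical decomposition. -/
def ClassicalDecomposability (S : DynamicalStateSpace A) : Prop :=
  ∀ x ∈ S.states, ∃ (n : ℕ) (p : Fin n → ℝ) (w : Fin n → A), S.IsClassicalDecomposition x p w

/-- Strong symmetry: any two families of `n` perfectly distinguishable pure states are related
by a reversible transformation. -/
def StrongSymmetry (S : DynamicalStateSpace A) : Prop :=
  ∀ (n : ℕ) (w v : Fin n → A), S.IsFrame w → S.IsFrame v →
    ∃ T ∈ S.reversible, ∀ j, T (w j) = v j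

end DynamicalStateSpace

/-- `-∑ pⱼ ln pⱼ`, with `0 ln 0 = 0`. -/
noncomputable def coefficientEntropy {n : ℕ} (p : Fin n → ℝ) : ℝ :=
  -∑ j, p j * Real.log (p j)

end

end GPT

/-!
The group of reversible transformations is equicontinuous, because it preserves the compact
spanning set of states; hence it fixes a state `μ` (`exists_invariant_state`). In a classical
decomposition `μ = ∑ pⱼ wⱼ` every permutation of the `wⱼ` is induced by a reversible transformation,
which fixes `μ`, so all `pⱼ` are equal: `∑ⱼ wⱼ = n μ`. By strong symmetry every frame of `n` states
has this same sum, and every frame is part of a frame of `n` states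
(`exists_capacity`, `IsFrame.exists_extension`).

Let `e₁, …, eₘ` be effects that distinguish a frame `w` and come from distinguishing effects of such
an extension. For any other frame `w'` one gets `∑ₖ eⱼ(w'ₖ) ≤ eⱼ(n μ) = 1`
(`IsFrame.exists_effects`), while `∑ⱼ eⱼ(w'ₖ) ≤ 1` holds by definition. If
`∑ pⱼ wⱼ = ∑ qₖ w'ₖ`, then `pⱼ = ∑ₖ eⱼ(w'ₖ) qₖ`, so a doubly substochastic matrix takes `q` to `p`,
and another one takes `p` to `q`. Hence `p` and `q` weakly majorize each other, that is,
`∑ⱼ (pⱼ - t)⁺ = ∑ₖ (qₖ - t)⁺` for all `t ≥ 0`. The second differences of these functions of `t`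
count how often each positive number occurs among the coefficients.
-/

/-! ### Fixed points of equicontinuous groups -/

/-- An equicontinuous group of linear maps that preserves a nonempty compact convex set has a fixed
point in it: the minimizer of the invariant, uniformly convex function `x ↦ sup_T ‖T x‖²`, for a
Euclidean norm. -/
theorem exists_mem_forall_apply_eq {A : Type*} [NormedAddCommGroup A] [NormedSpace ℝ A]
    [FiniteDimensional ℝ A] (G : Subgroup (A ≃ₗ[ℝ] A)) {C : ℝ}
    (hC : ∀ T ∈ G, ∀ x, ‖T x‖ ≤ C * ‖x‖) {K : Set A} (hcomp : IsCompact K) (hconv : Convex ℝ K)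
    (hne : K.Nonempty) (hK : ∀ T ∈ G, ∀ x ∈ K, T x ∈ K) :
    ∃ x ∈ K, ∀ T ∈ G, T x = x := by
  let φ : A ≃L[ℝ] EuclideanSpace ℝ (Fin (Module.finrank ℝ A)) := toEuclidean
  let N : G → A → ℝ := fun T x => ‖φ (T.1 x)‖ ^ 2
  have hcont (T : G) : Continuous (N T) := by
    have : Continuous (T.1 : A → A) := T.1.toLinearMap.continuous_of_finiteDimensional
    fun_prop
  have hbdd (x : A) : BddAbove (Set.range fun T => N T x) := by
    refine ⟨(‖φ.toContinuousLinearMap‖ * (C * ‖x‖)) ^ 2, ?_⟩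
    rintro _ ⟨T, rfl⟩
    refine pow_le_pow_left₀ (norm_nonneg _) ?_ 2
    exact (φ.toContinuousLinearMap.le_opNorm _).trans
      (mul_le_mul_of_nonneg_left (hC _ T.2 x) (norm_nonneg _))
  let F : A → ℝ := fun x => ⨆ T : G, N T x
  have hlsc : LowerSemicontinuous F :=
    lowerSemicontinuous_ciSup hbdd fun T => (hcont T).lowerSemicontinuous
  obtain ⟨x, hxK, hx⟩ := (hlsc.lowerSemicontinuousOn K).exists_isMinOn hne hcomp
  refine ⟨x, hxK, fun S hS => ?_⟩
  by_contra hne'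
  have hpos : 0 < ‖x - S x‖ := norm_pos_iff.2 (sub_ne_zero.2 (Ne.symm hne'))
  let D := C * ‖φ.symm.toContinuousLinearMap‖
  -- As `T⁻¹` is bounded uniformly as well, `T` cannot shrink a vector too much.
  have hD (T : G) (z : A) : ‖z‖ ≤ D * ‖φ (T.1 z)‖ := by
    have h1 := hC _ (G.inv_mem T.2) (T.1 z)
    have h2 : (T.1⁻¹ : A ≃ₗ[ℝ] A) (T.1 z) = z := T.1.symm_apply_apply z
    have h3 := φ.symm.toContinuousLinearMap.le_opNorm (φ (T.1 z))
    have hC0 : 0 ≤ C := by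
      have := (norm_nonneg _).trans (hC 1 G.one_mem (x - S x))
      exact nonneg_of_mul_nonneg_left this hpos
    simp only [ContinuousLinearEquiv.coe_coe, ContinuousLinearEquiv.symm_apply_apply] at h3
    rw [h2] at h1
    calc ‖z‖ ≤ C * ‖T.1 z‖ := h1
      _ ≤ C * (‖φ.symm.toContinuousLinearMap‖ * ‖φ (T.1 z)‖) := mul_le_mul_of_nonneg_left h3 hC0
      _ = _ := by ring
  have hDpos : 0 < D := by
    have h := hpos.trans_le (hD 1 (x - S x))
    exact pos_of_mul_pos_left h (norm_nonneg _)
  let y := (1 / 2 : ℝ) • x + (1 / 2 : ℝ) • S x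
  have hy : y ∈ K := hconv hxK (hK S hS x hxK) (by norm_num) (by norm_num) (by norm_num)
  -- If `x ≠ S x`, the parallelogram law makes `F` smaller at their midpoint `y` than at `x`, by an
  -- amount that does not depend on `T`.
  have hNy (T : G) : N T y ≤ F x - (‖x - S x‖ / D) ^ 2 / 4 := by
    have h1 : N T x ≤ F x := le_ciSup (hbdd x) T
    have h2 : N T (S x) ≤ F x := by
      have h := le_ciSup (hbdd x) (T * ⟨S, hS⟩)
      simpa only [N, Subgroup.coe_mul, LinearEquiv.mul_apply] using h
    have h3 : (‖x - S x‖ / D) ^ 2 ≤ ‖φ (T.1 (x - S x))‖ ^ 2 := by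
      refine pow_le_pow_left₀ (by positivity) ?_ 2
      rw [div_le_iff₀' hDpos]
      exact hD T _
    have h4 := parallelogram_law_with_norm ℝ (φ (T.1 x)) (φ (T.1 (S x)))
    have h5 : N T y = (1 / 4) * ‖φ (T.1 x) + φ (T.1 (S x))‖ ^ 2 := by
      have : φ (T.1 y) = (1 / 2 : ℝ) • (φ (T.1 x) + φ (T.1 (S x))) := by
        simp [y, smul_add]
      simp only [N, this, norm_smul, mul_pow]
      norm_num
    rw [map_sub, map_sub] at h3
    simp only [N] at h1 h2
    rw [h5]
    nlinarith
  have h1 : F y ≤ F x - (‖x - S x‖ / D) ^ 2 / 4 := ciSup_le hNy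
  have h2 : F x ≤ F y := hx hy
  have h3 : 0 < (‖x - S x‖ / D) ^ 2 := by positivity
  linarith

/-! ### Finite families that weakly majorize each other -/

theorem sum_comp_le_sum_of_injective {ι κ : Type*} [Fintype ι] [Fintype κ] {f : ι → κ}
    (hf : Function.Injective f) {a : κ → ℝ} (ha : ∀ k, 0 ≤ a k) : ∑ j, a (f j) ≤ ∑ k, a k := by
  classical
  rw [← Finset.sum_image (f := a) (s := Finset.univ) (g := f) hf.injOn]
  exact Finset.sum_le_sum_of_subset_of_nonneg (Finset.subset_univ _) fun k _ _ => ha k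

/-- A doubly substochastic matrix does not increase `∑ (· - t)⁺`, for `t ≥ 0`. -/
theorem sum_max_sub_le_of_substochastic {ι κ : Type*} [Fintype ι] [Fintype κ]
    {M : ι → κ → ℝ} (hM : ∀ j k, 0 ≤ M j k) (hrow : ∀ j, ∑ k, M j k ≤ 1)
    (hcol : ∀ k, ∑ j, M j k ≤ 1) {p : ι → ℝ} {q : κ → ℝ} (hp : ∀ j, p j = ∑ k, M j k * q k)
    {t : ℝ} (ht : 0 ≤ t) : ∑ j, max (p j - t) 0 ≤ ∑ k, max (q k - t) 0 := by
  have h (j : ι) : max (p j - t) 0 ≤ ∑ k, M j k * max (q k - t) 0 := by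
    refine max_le ?_ (Finset.sum_nonneg fun k _ => mul_nonneg (hM j k) (le_max_right _ _))
    calc p j - t ≤ p j - (∑ k, M j k) * t := by nlinarith [hrow j]
      _ = ∑ k, M j k * (q k - t) := by
        simp only [mul_sub, Finset.sum_sub_distrib, Finset.sum_mul, hp]
      _ ≤ _ := Finset.sum_le_sum fun k _ => mul_le_mul_of_nonneg_left (le_max_left _ _) (hM j k)
  calc ∑ j, max (p j - t) 0 ≤ ∑ j, ∑ k, M j k * max (q k - t) 0 := Finset.sum_le_sum fun j _ => h j
    _ = ∑ k, (∑ j, M j k) * max (q k - t) 0 := by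
      rw [Finset.sum_comm]
      simp only [Finset.sum_mul]
    _ ≤ ∑ k, max (q k - t) 0 := Finset.sum_le_sum fun k _ =>
      mul_le_of_le_one_left (le_max_right _ _) (hcol k)

/-- For small `h > 0`, the second difference of `t ↦ (c - t)⁺` at `a` with step `h` is the tent
function at `a`, which does not see `c ≠ a`. -/
theorem eventually_second_difference_max_sub (a c : ℝ) : ∀ᶠ h in nhdsWithin (0 : ℝ) (Set.Ioi 0),
    max (c - (a - h)) 0 - 2 * max (c - a) 0 + max (c - (a + h)) 0 = if c = a then h else 0 := by
  rcases eq_or_ne c a with rfl | hca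
  · filter_upwards [self_mem_nhdsWithin] with h hh
    have hh : 0 < h := hh
    rw [max_eq_left (by linarith), max_eq_right (by linarith), max_eq_right (by linarith)]
    simp
  · filter_upwards [self_mem_nhdsWithin,
      nhdsWithin_le_nhds (eventually_lt_nhds (abs_pos.2 (sub_ne_zero.2 hca)))] with h hh hlt
    have hh : 0 < h := hh
    rw [if_neg hca]
    rcases lt_or_gt_of_ne hca with hlt' | hgt
    · rw [abs_of_neg (by linarith)] at hlt
      rw [max_eq_right (by linarith), max_eq_right (by linarith), max_eq_right (by linarith)]
      simp
    · rw [abs_of_pos (by linarith)] at hlt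
      rw [max_eq_left (by linarith), max_eq_left (by linarith), max_eq_left (by linarith)]
      ring

theorem card_fiber_eq_of_sum_max_sub_eq {ι κ : Type*} [Fintype ι] [Fintype κ] {p : ι → ℝ}
    {q : κ → ℝ} (hpq : ∀ t, 0 ≤ t → ∑ j, max (p j - t) 0 = ∑ k, max (q k - t) 0) {a : ℝ}
    (ha : 0 < a) : Fintype.card {j // p j = a} = Fintype.card {k // q k = a} := by
  obtain ⟨h, ⟨⟨hp, hq⟩, hh⟩, hha⟩ :=
    ((((Filter.eventually_all.2 fun j => eventually_second_difference_max_sub a (p j)).and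
      (Filter.eventually_all.2 fun k => eventually_second_difference_max_sub a (q k))).and
      (self_mem_nhdsWithin : ∀ᶠ h in nhdsWithin (0 : ℝ) (Set.Ioi 0), h ∈ Set.Ioi 0)).and
      (nhdsWithin_le_nhds (eventually_lt_nhds ha))).exists
  have hh : 0 < h := hh
  have h1 := Finset.sum_congr rfl fun j (_ : j ∈ Finset.univ) => hp j
  have h2 := Finset.sum_congr rfl fun k (_ : k ∈ Finset.univ) => hq k
  rw [Finset.sum_add_distrib, Finset.sum_sub_distrib, ← Finset.mul_sum] at h1 h2
  rw [hpq _ (by linarith), hpq _ ha.le, hpq _ (by linarith), h2, ← Finset.sum_filter,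
    ← Finset.sum_filter, Finset.sum_const, Finset.sum_const, nsmul_eq_mul, nsmul_eq_mul] at h1
  rw [Fintype.card_subtype, Fintype.card_subtype]
  exact_mod_cast (mul_right_cancel₀ hh.ne' h1).symm

theorem exists_equiv_of_card_fiber_eq {α β γ : Type*} [Fintype α] [Fintype β] [DecidableEq γ]
    {f : α → γ} {g : β → γ}
    (h : ∀ c, Fintype.card {x // f x = c} = Fintype.card {y // g y = c}) :
    ∃ σ : α ≃ β, ∀ x, g (σ x) = f x := by
  refine ⟨(Equiv.sigmaFiberEquiv f).symm.trans ((Equiv.sigmaCongrRight fun c =>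
    Fintype.equivOfCardEq (h c)).trans (Equiv.sigmaFiberEquiv g)), fun x => ?_⟩
  exact (Fintype.equivOfCardEq (h (f x)) ⟨x, rfl⟩).2

theorem exists_equiv_support_of_sum_max_sub_eq {ι κ : Type*} [Fintype ι] [Fintype κ] {p : ι → ℝ}
    {q : κ → ℝ} (hp : ∀ j, 0 ≤ p j) (hq : ∀ k, 0 ≤ q k)
    (hpq : ∀ t, 0 ≤ t → ∑ j, max (p j - t) 0 = ∑ k, max (q k - t) 0) :
    ∃ σ : {j // p j ≠ 0} ≃ {k // q k ≠ 0}, ∀ j, q (σ j) = p j := by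
  classical
  refine exists_equiv_of_card_fiber_eq (f := fun j : {j // p j ≠ 0} => p j)
    (g := fun k : {k // q k ≠ 0} => q k) fun c => ?_
  rcases le_or_gt c 0 with hc | hc
  · rw [Fintype.card_eq_zero_iff.2, Fintype.card_eq_zero_iff.2]
    · exact ⟨fun ⟨⟨k, hk⟩, hkc⟩ => hk (le_antisymm (hkc.trans_le hc) (hq k))⟩
    · exact ⟨fun ⟨⟨j, hj⟩, hjc⟩ => hj (le_antisymm (hjc.trans_le hc) (hp j))⟩
  · rw [Fintype.card_congr (Equiv.subtypeSubtypeEquivSubtype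
        (p := fun j => p j ≠ 0) (q := fun j => p j = c) fun h => h.trans_ne hc.ne'),
      Fintype.card_congr (Equiv.subtypeSubtypeEquivSubtype
        (p := fun k => q k ≠ 0) (q := fun k => q k = c) fun h => h.trans_ne hc.ne')]
    exact card_fiber_eq_of_sum_max_sub_eq hpq hc

namespace GPT

theorem coefficientEntropy_eq_of_equiv {m n : ℕ} {p : Fin m → ℝ} {q : Fin n → ℝ}
    (σ : {j // p j ≠ 0} ≃ {k // q k ≠ 0}) (hσ : ∀ j, q (σ j) = p j) :
    coefficientEntropy p = coefficientEntropy q := by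
  have key {l : ℕ} (r : Fin l → ℝ) :
      ∑ j, r j * Real.log (r j) = ∑ j : {j // r j ≠ 0}, r j * Real.log (r j) := by
    rw [← Finset.sum_subtype (Finset.univ.filter fun j => r j ≠ 0) (by simp)
      fun j => r j * Real.log (r j), Finset.sum_filter_of_ne]
    exact fun j _ h => left_ne_zero_of_mul h
  rw [coefficientEntropy, coefficientEntropy, key, key, ← σ.sum_comp]
  simp only [hσ]

namespace DynamicalStateSpace

variable {A : Type*} [NormedAddCommGroup A] [NormedSpace ℝ A] [FiniteDimensional ℝ A]
  {S : DynamicalStateSpace A}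

/-! ### Reversible transformations -/

theorem mem_cone_of_mem_states {x : A} (hx : x ∈ S.states) : x ∈ S.cone :=
  ⟨1, zero_le_one, x, hx, (one_smul ℝ x).symm⟩

theorem unit_eq_one_of_mem_states {x : A} (hx : x ∈ S.states) : S.unit x = 1 :=
  (S.unit_eq_one_iff x (mem_cone_of_mem_states hx)).2 hx

theorem unit_apply_reversible {T : A ≃ₗ[ℝ] A} (hT : T ∈ S.reversible) {x : A} (hx : x ∈ S.cone) :
    S.unit (T x) = S.unit x := by
  have h := S.isTransformation_of_reversible T hT
  have h' := (S.isTransformation_of_reversible _ (S.reversible.inv_mem hT)).2 _ (h.1 x hx)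
  refine le_antisymm (h.2 x hx) ?_
  have e : (T⁻¹ : A ≃ₗ[ℝ] A) (T x) = x := T.symm_apply_apply x
  simpa [e] using h'

theorem apply_mem_states {T : A ≃ₗ[ℝ] A} (hT : T ∈ S.reversible) {x : A} (hx : x ∈ S.states) :
    T x ∈ S.states := by
  have hc := mem_cone_of_mem_states hx
  refine (S.unit_eq_one_iff _ ((S.isTransformation_of_reversible T hT).1 x hc)).1 ?_
  exact (unit_apply_reversible hT hc).trans (unit_eq_one_of_mem_states hx)

theorem symm_apply_mem_states {T : A ≃ₗ[ℝ] A} (hT : T ∈ S.reversible) {x : A}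
    (hx : x ∈ S.states) : T.symm x ∈ S.states :=
  apply_mem_states (S.reversible.inv_mem hT) hx

theorem apply_mem_pureStates {T : A ≃ₗ[ℝ] A} (hT : T ∈ S.reversible) {x : A}
    (hx : x ∈ S.pureStates) : T x ∈ S.pureStates := by
  have himage : T '' S.states = S.states := by
    refine Set.Subset.antisymm ?_ fun y hy => ⟨T.symm y, symm_apply_mem_states hT hy, by simp⟩
    rintro _ ⟨y, hy, rfl⟩
    exact apply_mem_states hT hy
  have h := image_extremePoints T S.states
  rw [himage] at h
  exact h.subset (Set.mem_image_of_mem T hx)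

/-- The reversible transformations are uniformly bounded: orbits of states are bounded and the
states span the space, so that the Banach–Steinhaus theorem applies. -/
theorem exists_norm_apply_le (S : DynamicalStateSpace A) :
    ∃ C : ℝ, ∀ T ∈ S.reversible, ∀ x, ‖T x‖ ≤ C * ‖x‖ := by
  obtain ⟨R, hR⟩ := S.isCompact_states.isBounded.exists_norm_le
  have : CompleteSpace A := FiniteDimensional.complete ℝ A
  have hpt (x : A) : ∃ C, ∀ T : S.reversible, ‖T.1 x‖ ≤ C := by
    have hx : x ∈ Submodule.span ℝ (nonnegMultiples S.states) := by
      rw [S.generating]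
      trivial
    induction hx using Submodule.span_induction with
    | mem x hx =>
      obtain ⟨t, ht, w, hw, rfl⟩ := hx
      refine ⟨t * R, fun T => ?_⟩
      rw [map_smul, norm_smul, Real.norm_of_nonneg ht]
      exact mul_le_mul_of_nonneg_left (hR _ (apply_mem_states T.2 hw)) ht
    | zero => exact ⟨0, fun T => by simp⟩
    | add x y _ _ hx hy =>
      obtain ⟨a, ha⟩ := hx
      obtain ⟨b, hb⟩ := hy
      refine ⟨a + b, fun T => ?_⟩
      rw [map_add]
      exact (norm_add_le _ _).trans (add_le_add (ha T) (hb T))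
    | smul c x _ hx =>
      obtain ⟨a, ha⟩ := hx
      refine ⟨‖c‖ * a, fun T => ?_⟩
      rw [map_smul, norm_smul]
      exact mul_le_mul_of_nonneg_left (ha T) (norm_nonneg c)
  obtain ⟨C, hC⟩ := banach_steinhaus
    (g := fun T : S.reversible => LinearMap.toContinuousLinearMap (T.1 : A →ₗ[ℝ] A)) hpt
  exact ⟨C, fun T hT x => ContinuousLinearMap.le_of_opNorm_le _ (hC ⟨T, hT⟩) x⟩

theorem exists_invariant_state (S : DynamicalStateSpace A) (hne : S.states.Nonempty) :
    ∃ μ ∈ S.states, ∀ T ∈ S.reversible, T μ = μ := by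
  obtain ⟨C, hC⟩ := S.exists_norm_apply_le
  exact exists_mem_forall_apply_eq S.reversible hC S.isCompact_states S.convex_states hne
    fun T hT x hx => apply_mem_states hT hx

/-! ### Frames -/

/-- A subfamily of a frame is a frame. -/
theorem IsFrame.comp_injective {m n : ℕ} {w : Fin n → A} (hw : S.IsFrame w) {f : Fin m → Fin n}
    (hf : Function.Injective f) : S.IsFrame (w ∘ f) := by
  obtain ⟨hpure, hstates, e, he, hsum, hδ⟩ := hw
  refine ⟨fun j => hpure (f j), fun j => hstates (f j), e ∘ f, fun j => he (f j),
    fun x hx => ?_, fun j k => by simp [hδ, hf.eq_iff]⟩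
  exact (sum_comp_le_sum_of_injective hf fun i =>
    (S.isEffect_of_allowed _ (he i) x hx).1).trans (hsum x hx)

theorem IsFrame.map {n : ℕ} {w : Fin n → A} (hw : S.IsFrame w) {T : A ≃ₗ[ℝ] A}
    (hT : T ∈ S.reversible) : S.IsFrame fun j => T (w j) := by
  obtain ⟨hpure, hstates, e, he, hsum, hδ⟩ := hw
  have hinv := S.reversible.inv_mem hT
  refine ⟨fun j => apply_mem_pureStates hT (hpure j), fun j => apply_mem_states hT (hstates j),
    fun j => e j ∘ₗ ((T⁻¹ : A ≃ₗ[ℝ] A) : A →ₗ[ℝ] A), fun j => S.comp_allowed _ (he j) _ hinv,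
    fun x hx => ?_, fun j k => ?_⟩
  · have h := S.isTransformation_of_reversible _ hinv
    exact (hsum _ (h.1 x hx)).trans (h.2 x hx)
  · simp [hδ]

/-- There are a number `n ≥ 1` and a point `μ` such that some frame has `n` elements and
every frame with `n` elements sums to `n μ`: the invariant state and the number of states in one of
its classical decompositions. -/
theorem exists_capacity (hdec : S.ClassicalDecomposability) (hsym : S.StrongSymmetry)
    (hne : S.states.Nonempty) :
    ∃ (n : ℕ) (μ : A), 0 < n ∧ (∃ w : Fin n → A, S.IsFrame w) ∧
      ∀ w : Fin n → A, S.IsFrame w → ∑ j, w j = (n : ℝ) • μ := by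
  obtain ⟨μ, hμ, hinv⟩ := S.exists_invariant_state hne
  obtain ⟨n, p, w, hp⟩ := hdec μ hμ
  have hw := hp.isFrame
  obtain ⟨e, -, -, hδ⟩ := hw.2.2
  -- The transformation that swaps `wᵢ` and `wⱼ` fixes `μ`, so the coefficients `pᵢ` and `pⱼ` agree.
  have hconst (i j : Fin n) : p i = p j := by
    obtain ⟨T, hT, hTw⟩ := hsym n w (w ∘ Equiv.swap i j) hw
      (hw.comp_injective (Equiv.swap i j).injective)
    have h := hinv T hT
    rw [hp.eq_sum] at h
    have h' := congrArg (e i) h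
    have hk (k : Fin n) : i = Equiv.swap i j k ↔ k = j := by
      rw [eq_comm, Equiv.swap_apply_eq_iff, Equiv.swap_apply_left]
    simpa [hTw, hδ, hk] using h'.symm
  have hn : 0 < n := by
    rcases Nat.eq_zero_or_pos n with rfl | h
    · simpa using hp.sum_eq_one
    · exact h
  have hpn (j : Fin n) : (n : ℝ) * p j = 1 := by
    have h := hp.sum_eq_one
    rw [Finset.sum_congr rfl fun i _ => hconst i j] at h
    simpa using h
  have hsumw : ∑ j, w j = (n : ℝ) • μ := by
    rw [hp.eq_sum, Finset.smul_sum]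
    exact Finset.sum_congr rfl fun j _ => by rw [smul_smul, hpn, one_smul]
  refine ⟨n, μ, hn, ⟨w, hw⟩, fun v hv => ?_⟩
  obtain ⟨T, hT, hTw⟩ := hsym n w v hw hv
  rw [← Finset.sum_congr rfl fun j _ => hTw j, ← map_sum, hsumw, map_smul, hinv T hT]

/-- If all frames with `n ≥ 1` elements have the same sum, no frame has more than `n` elements:
its effects would distinguish the sums of two of its subfamilies. -/
theorem IsFrame.card_le {n : ℕ} {ν : A} (hn : 0 < n)
    (hν : ∀ w : Fin n → A, S.IsFrame w → ∑ j, w j = ν) {m : ℕ} {v : Fin m → A}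
    (hv : S.IsFrame v) : m ≤ n := by
  by_contra! hlt
  obtain ⟨e, -, -, hδ⟩ := hv.2.2
  let f : Fin n → Fin m := Fin.castLE hlt.le
  have hf : Function.Injective f := Fin.castLE_injective _
  let last : Fin m := ⟨n, hlt⟩
  let g : Fin n → Fin m := Equiv.swap (f ⟨0, hn⟩) last ∘ f
  have hg : Function.Injective g := (Equiv.injective _).comp hf
  have hg0 : g ⟨0, hn⟩ = last := Equiv.swap_apply_left _ _
  have h := (hν _ (hv.comp_injective hf)).trans (hν _ (hv.comp_injective hg)).symm
  have h' := congrArg (e last) h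
  rw [map_sum, map_sum] at h'
  have hz : ∑ j, e last ((v ∘ f) j) = 0 := Finset.sum_eq_zero fun j _ => by
    have : last ≠ f j := fun hj => absurd (congrArg Fin.val hj) j.2.ne'
    simp [hδ, this]
  have h1 : (1 : ℝ) ≤ ∑ j, e last ((v ∘ g) j) := by
    have h2 := Finset.single_le_sum (f := fun j => e last ((v ∘ g) j))
      (fun j _ => by simp only [Function.comp_apply, hδ]; split_ifs <;> norm_num)
      (Finset.mem_univ (⟨0, hn⟩ : Fin n))
    simpa [hg0, hδ] using h2
  linarith

/-- By strong symmetry, a frame is part of a frame with any larger possible number of elements. -/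
theorem IsFrame.exists_extension (hsym : S.StrongSymmetry) {m n : ℕ} (hmn : m ≤ n)
    {w : Fin n → A} (hw : S.IsFrame w) {v : Fin m → A} (hv : S.IsFrame v) :
    ∃ V : Fin n → A, S.IsFrame V ∧ ∀ j, V (Fin.castLE hmn j) = v j := by
  obtain ⟨T, hT, hTw⟩ := hsym m _ v (hw.comp_injective (Fin.castLE_injective hmn)) hv
  exact ⟨_, hw.map hT, hTw⟩

/-- A frame can be distinguished by effects whose values on the elements of any other frame sum to
at most `1`. -/
theorem IsFrame.exists_effects (hdec : S.ClassicalDecomposability) (hsym : S.StrongSymmetry)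
    {m : ℕ} {v : Fin m → A} (hv : S.IsFrame v) (hne : S.states.Nonempty) :
    ∃ e : Fin m → Module.Dual ℝ A, (∀ j, ∀ x ∈ S.states, 0 ≤ e j x) ∧
      (∀ x ∈ S.states, ∑ j, e j x ≤ 1) ∧ (∀ j k, e j (v k) = if j = k then 1 else 0) ∧
      ∀ (l : ℕ) (w : Fin l → A), S.IsFrame w → ∀ j, ∑ k, e j (w k) ≤ 1 := by
  obtain ⟨n, μ, hn, ⟨b, hb⟩, hsum⟩ := exists_capacity hdec hsym hne
  have hmn := hv.card_le hn hsum
  obtain ⟨V, hV, hVv⟩ := hb.exists_extension hsym hmn hv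
  obtain ⟨E, hE, hEsum, hδ⟩ := hV.2.2
  have hpos (i : Fin n) {x : A} (hx : x ∈ S.states) : 0 ≤ E i x :=
    (S.isEffect_of_allowed _ (hE i) x (mem_cone_of_mem_states hx)).1
  have hinj := Fin.castLE_injective hmn
  refine ⟨fun j => E (Fin.castLE hmn j), fun j x hx => hpos _ hx, fun x hx => ?_, fun j k => ?_,
    fun l w hw j => ?_⟩
  · rw [← unit_eq_one_of_mem_states hx]
    exact (sum_comp_le_sum_of_injective hinj fun i => hpos i hx).trans
      (hEsum x (mem_cone_of_mem_states hx))
  · rw [← hVv, hδ]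
    simp [hinj.eq_iff]
  · have hln := hw.card_le hn hsum
    obtain ⟨W, hW, hWw⟩ := hb.exists_extension hsym hln hw
    have h1 : ∑ i, E (Fin.castLE hmn j) (W i) = 1 := by
      rw [← map_sum, hsum W hW, ← hsum V hV, map_sum]
      simp [hδ]
    rw [← h1, ← Finset.sum_congr rfl fun k _ => congrArg _ (hWw k)]
    exact sum_comp_le_sum_of_injective (a := fun i => E (Fin.castLE hmn j) (W i))
      (Fin.castLE_injective hln) fun i => hpos _ (hW.2.1 i)

/-! ### Uniqueness of the coefficients -/

/-- The coefficients of one classical decomposition are weakly majorized by those of another. -/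
theorem IsClassicalDecomposition.sum_max_sub_le (hdec : S.ClassicalDecomposability)
    (hsym : S.StrongSymmetry) {x : A} (hx : x ∈ S.states) {m n : ℕ} {p : Fin m → ℝ}
    {w : Fin m → A} {q : Fin n → ℝ} {w' : Fin n → A} (hp : S.IsClassicalDecomposition x p w)
    (hq : S.IsClassicalDecomposition x q w') {t : ℝ} (ht : 0 ≤ t) :
    ∑ j, max (p j - t) 0 ≤ ∑ k, max (q k - t) 0 := by
  obtain ⟨e, hpos, hsum, hδ, hrow⟩ := hp.isFrame.exists_effects hdec hsym ⟨x, hx⟩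
  have hstates := hq.isFrame.2.1
  refine sum_max_sub_le_of_substochastic (M := fun j k => e j (w' k))
    (fun j k => hpos j _ (hstates k)) (fun j => hrow n w' hq.isFrame j)
    (fun k => hsum _ (hstates k)) (fun j => ?_) ht
  have h := congrArg (e j) (hp.eq_sum.symm.trans hq.eq_sum)
  simpa [hδ, mul_comm] using h

theorem IsClassicalDecomposition.exists_equiv (hdec : S.ClassicalDecomposability)
    (hsym : S.StrongSymmetry) {x : A} (hx : x ∈ S.states) {m n : ℕ} {p : Fin m → ℝ}
    {w : Fin m → A} {q : Fin n → ℝ} {w' : Fin n → A} (hp : S.IsClassicalDecomposition x p w)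
    (hq : S.IsClassicalDecomposition x q w') :
    ∃ σ : {j // p j ≠ 0} ≃ {k // q k ≠ 0}, ∀ j, q (σ j) = p j :=
  exists_equiv_support_of_sum_max_sub_eq hp.nonneg hq.nonneg fun _ ht =>
    le_antisymm (hp.sum_max_sub_le hdec hsym hx hq ht) (hq.sum_max_sub_le hdec hsym hx hp ht)

end DynamicalStateSpace

end GPT

theorem mainTheorem1 {A : Type*} [NormedAddCommGroup A] [NormedSpace ℝ A]
    [FiniteDimensional ℝ A] (S : GPT.DynamicalStateSpace A)
    (hdec : S.ClassicalDecomposability) (hsym : S.StrongSymmetry) :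
    (∀ x ∈ S.states, ∀ (m n : ℕ) (p : Fin m → ℝ) (w : Fin m → A) (q : Fin n → ℝ) (w' : Fin n → A),
      S.IsClassicalDecomposition x p w → S.IsClassicalDecomposition x q w' →
        (∃ σ : {j // p j ≠ 0} ≃ {k // q k ≠ 0}, ∀ j, q (σ j) = p j) ∧
        GPT.coefficientEntropy p = GPT.coefficientEntropy q) ∧
    (∀ x ∈ S.states, ∃! s : ℝ, ∀ (n : ℕ) (p : Fin n → ℝ) (w : Fin n → A),
      S.IsClassicalDecomposition x p w → s = GPT.coefficientEntropy p) := by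
  have key : ∀ x ∈ S.states, ∀ (m n : ℕ) (p : Fin m → ℝ) (w : Fin m → A) (q : Fin n → ℝ)
      (w' : Fin n → A), S.IsClassicalDecomposition x p w → S.IsClassicalDecomposition x q w' →
        (∃ σ : {j // p j ≠ 0} ≃ {k // q k ≠ 0}, ∀ j, q (σ j) = p j) ∧
        GPT.coefficientEntropy p = GPT.coefficientEntropy q := by
    intro x hx m n p w q w' hp hq
    obtain ⟨σ, hσ⟩ := hp.exists_equiv hdec hsym hx hq
    exact ⟨⟨σ, hσ⟩, GPT.coefficientEntropy_eq_of_equiv σ hσ⟩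
  refine ⟨key, fun x hx => ?_⟩
  obtain ⟨n, p, w, hp⟩ := hdec x hx
  exact ⟨GPT.coefficientEntropy p, fun m q w' hq => (key x hx n m p w q w' hp hq).2,
    fun s hs => hs n p w hp⟩
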